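/- Let $(A,\mathfrak m)$ be a Cohen–Macaulay (commutative Noetherian) local ring of Krull dimension $d$, and let $p\ge 0$ be an integer. Call an $A$-module $M$ *pure weight $p$* if it is finitely generated, has projective dimension at most $p$, and is supported on $V(I)=\{\mathfrak q\in\operatorname{Spec}A : I\subseteq\mathfrak q\}$ for some ideal $I\subset A$ generated by an $A$-regular sequence of $p$ elements. Let $M$ be a non-zero pure weight $p$ $A$-module. Then: 1. $p\le d$ and $M$ is a Cohen–Macaulay $A$-module of dimension $d-p$, i.e. $\operatorname{depth}_A M=\dim_A M=d-p$. 2. Every associated prime ideal of $M$ is a minimal element of $\operatorname{Supp}_A M$. -/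

import Mathlib

universe u v

namespace PureWeight

open CategoryTheory RingTheory.Sequence

/-- The `I`-depth of an `A`-module `M`: the supremum of the lengths of the `M`-regular sequences
with entries in `I` if `I M ≠ M`, and `∞` if `I M = M`. -/
noncomputable def idealDepth {A : Type u} [CommRing A] (I : Ideal A) (M : Type v) [AddCommGroup M]
    [Module A M] : ℕ∞ :=
  open Classical in
  if I • (⊤ : Submodule A M) = ⊤ then ⊤
  else ⨆ rs : {rs : List A // IsRegular M rs ∧ ∀ r ∈ rs, r ∈ I}, (rs.1.length : ℕ∞)

/-- The depth of a module over a local ring, with respect to the maximal ideal. -/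
noncomputable def depth (A : Type u) [CommRing A] [IsLocalRing A] (M : Type v) [AddCommGroup M]
    [Module A M] : ℕ∞ :=
  idealDepth (IsLocalRing.maximalIdeal A) M

/-- A finitely generated module over a local ring is Cohen–Macaulay if it is zero or its depth
equals the Krull dimension of its support. -/
def IsCohenMacaulayModule (A : Type u) [CommRing A] [IsLocalRing A] (M : Type v) [AddCommGroup M]
    [Module A M] : Prop :=
  Module.Finite A M ∧
    (Subsingleton M ∨ ((depth A M : ℕ∞) : WithBot ℕ∞) = Module.supportDim A M)

/-- A local ring is Cohen–Macaulay if it is Noetherian and its depth equals its Krull dimension. -/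
def IsCohenMacaulayLocalRing (A : Type u) [CommRing A] [IsLocalRing A] : Prop :=
  IsNoetherianRing A ∧ ((depth A A : ℕ∞) : WithBot ℕ∞) = ringKrullDim A

/-- `M` is a pure weight `r` module supported on the ideal `I`: the ideal `I` is generated by an
`A`-regular sequence of `r` elements, and `M` is a finitely generated `A`-module of projective
dimension at most `r` whose support is contained in `V(I)`. -/
structure IsPureWeightOn {A : Type u} [CommRing A] [Small.{v} A] (I : Ideal A) (r : ℕ)
    (M : Type v) [AddCommGroup M] [Module A M] : Prop where
  exists_regular : ∃ rs : List A, IsRegular A rs ∧ rs.length = r ∧ Ideal.ofList rs = I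
  finite : Module.Finite A M
  support_subset : Module.support A M ⊆ PrimeSpectrum.zeroLocus (I : Set A)
  projectiveDimension_le : HasProjectiveDimensionLE (ModuleCat.of A M) r

/-- `M` is a pure weight `r` module over `A`: it is one supported on some ideal generated by
an `A`-regular sequence of `r` elements. -/
def IsPureWeight (A : Type u) [CommRing A] [Small.{v} A] (r : ℕ)
    (M : Type v) [AddCommGroup M] [Module A M] : Prop :=
  ∃ I : Ideal A, IsPureWeightOn I r M

end PureWeight

namespace PureWeight

open CategoryTheory Abelian RingTheory.Sequence IsLocalRing Pointwise

section AssociatedPrime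

variable {A : Type u} [CommRing A] [IsNoetherianRing A]

/-! Dividing by `I` lowers the dimension of `A` by `p`, so `dim M ≤ d - p`. Conversely, for `N`
finite and supported at the closed point, `Ext N A i` vanishes for `i < d`; shifting along syzygies
costs one degree per unit of projective dimension, so `Ext N M i` vanishes for `i < d - p`, and the
Ext criterion yields an `M`-regular sequence of length `d - p`. As depth is at most dimension, all
are equal. Such a sequence also starts a chain of `d - p` strict inclusions at any associated prime;
a smaller prime in the support would make the chain longer than `dim M`. -/

/-- If `x` in the Jacobson radical of `A` is `M`-regular, every associated prime
of `M` is strictly contained in an associated prime of `M / x M`. -/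
lemma exists_lt_isAssociatedPrime_quotSMulTop {M : Type v} [AddCommGroup M] [Module A M]
    [Module.Finite A M] {x : A} (hx : x ∈ Ring.jacobson A) (reg : IsSMulRegular M x)
    {P : Ideal A} (hP : IsAssociatedPrime P M) :
    ∃ Q : Ideal A, IsAssociatedPrime Q (QuotSMulTop x M) ∧ P < Q := by
  obtain ⟨hPp, m₀, hm₀⟩ := isAssociatedPrime_iff.mp hP
  have hP_mem (a : A) : a ∈ P ↔ a • m₀ = 0 := by
    rw [hm₀, Submodule.mem_colon_singleton, Submodule.mem_bot]
  have hm₀_ne : m₀ ≠ 0 := fun h ↦ hPp.ne_top <| (Ideal.eq_top_iff_one _).mpr <| by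
    rw [hP_mem, h, smul_zero]
  have hxP : x ∉ P := fun h ↦ hm₀_ne <| reg <| by
    simpa using (hP_mem x).mp h
  let N : Submodule A M := Submodule.torsionBySet A M P
  have hN_mem (n : M) : n ∈ N ↔ ∀ a ∈ P, a • n = 0 := by
    simp [N, Submodule.mem_torsionBySet_iff]
  -- Otherwise regularity of `x` gives `N ⊆ xN`, and Nakayama kills `N`, which contains `m₀ ≠ 0`.
  obtain ⟨n, hnN, hn⟩ : ∃ n ∈ N, n ∉ x • (⊤ : Submodule A M) := by
    by_contra! h
    have hle : N ≤ Ideal.span {x} • N := fun n hn ↦ by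
      obtain ⟨m, -, rfl⟩ := (Submodule.mem_smul_pointwise_iff_exists _ _ _).mp (h n hn)
      refine Submodule.smul_mem_smul (Ideal.mem_span_singleton_self x) ((hN_mem m).mpr ?_)
      intro a ha
      apply reg
      simpa [smul_comm x a m] using (hN_mem _).mp hn a ha
    have hN : N = ⊥ := Submodule.eq_bot_of_le_smul_of_le_jacobson_bot _ N (IsNoetherian.noetherian N)
      hle ((Ideal.span_singleton_le_iff_mem _).mpr (Ideal.jacobson_bot (R := A) ▸ hx))
    exact hm₀_ne <| (Submodule.mem_bot A).mp <| hN ▸ (hN_mem m₀).mpr fun a ↦ (hP_mem a).mp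
  -- The class of `n` is nonzero and killed by `P` and by `x ∉ P`; hence so strict an inclusion.
  obtain ⟨Q, hQ, hle⟩ := exists_le_isAssociatedPrime_of_isNoetherianRing A
    (Submodule.Quotient.mk n : QuotSMulTop x M) (by simpa [Submodule.Quotient.mk_eq_zero] using hn)
  have hmem (a : A) (ha : a • n ∈ x • (⊤ : Submodule A M)) : a ∈ Q := by
    apply hle
    rw [Submodule.mem_colon_singleton, Submodule.mem_bot, ← Submodule.Quotient.mk_smul]
    exact (Submodule.Quotient.mk_eq_zero _).mpr ha
  refine ⟨Q, hQ, lt_of_le_of_ne (fun a ha ↦ hmem a ?_) fun h ↦ hxP (h ▸ hmem x ?_)⟩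
  · rw [(hN_mem n).mp hnN a ha]
    exact Submodule.zero_mem _
  · exact Submodule.smul_mem_pointwise_smul n x ⊤ trivial

/-- Over a local ring, an associated prime of `M` is the start of a chain of primes as long as any
given `M`-regular sequence in the maximal ideal. -/
lemma exists_ltSeries_head_eq_of_isAssociatedPrime [IsLocalRing A] (rs : List A)
    (mem : ∀ r ∈ rs, r ∈ maximalIdeal A) {M : Type v} [AddCommGroup M] [Module A M]
    [Module.Finite A M] (reg : IsWeaklyRegular M rs) (P : PrimeSpectrum A)
    (hP : IsAssociatedPrime P.asIdeal M) :
    ∃ s : LTSeries (PrimeSpectrum A), s.head = P ∧ s.length = rs.length := by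
  induction rs generalizing M P with
  | nil => exact ⟨RelSeries.singleton _ P, rfl, rfl⟩
  | cons x rs ih =>
    simp only [List.mem_cons, forall_eq_or_imp] at mem
    rw [isWeaklyRegular_cons_iff] at reg
    obtain ⟨Q, hQ, hlt⟩ := exists_lt_isAssociatedPrime_quotSMulTop
      (by rw [ringJacobson_eq_maximalIdeal]; exact mem.1) reg.1 hP
    obtain ⟨s, hs, hlen⟩ := ih mem.2 reg.2 ⟨Q, hQ.isPrime⟩ hQ
    exact ⟨s.cons P (by rw [hs]; exact hlt), by simp, by simp [hlen]⟩

end AssociatedPrime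

/-- Supports are closed under specialization, so the head carries the whole chain. -/
lemma length_le_supportDim {A : Type u} [CommRing A] {M : Type v} [AddCommGroup M] [Module A M]
    (s : LTSeries (PrimeSpectrum A)) (hs : s.head ∈ Module.support A M) :
    (s.length : WithBot ℕ∞) ≤ Module.supportDim A M := by
  let t : LTSeries (Module.support A M) :=
    { length := s.length
      toFun := fun i ↦ ⟨s i, Module.mem_support_mono (s.head_le i) hs⟩
      step := fun i ↦ s.step i }
  exact Order.LTSeries.length_le_krullDim t

/-- If `A` has a regular sequence of length `n` in the maximal ideal and `M` has projective
dimension at most `p`, then `Ext N M i` vanishes for `i + p < n` and `N` supported at the closed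
point. -/
lemma subsingleton_ext_of_hasProjectiveDimensionLE {A : Type u} [CommRing A] [Small.{v} A]
    [IsLocalRing A] [IsNoetherianRing A] (rs : List A) (mem : ∀ r ∈ rs, r ∈ maximalIdeal A)
    (reg : IsWeaklyRegular A rs) (N : ModuleCat.{v} A) [Module.Finite A N]
    (hN : Module.support A N ⊆ PrimeSpectrum.zeroLocus (maximalIdeal A)) (p : ℕ)
    (M : ModuleCat.{v} A) [Module.Finite A M] [HasProjectiveDimensionLE M p]
    (i : ℕ) (hi : i + p < rs.length) : Subsingleton (Ext N M i) := by
  -- By flatness `rs` stays weakly regular on `F`; the zero module is split off because `IsRegular`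
  -- excludes it.
  have flat (F : ModuleCat.{v} A) [Module.Finite A F] [Module.Flat A F] (i : ℕ)
      (hi : i < rs.length) : Subsingleton (Ext N F i) := by
    cases subsingleton_or_nontrivial F with
    | inl h =>
      exact subsingleton_of_forall_eq 0 fun e ↦ by
        rw [← e.comp_mk₀_id, (ModuleCat.isZero_of_subsingleton F).eq_of_src (𝟙 F) 0, Ext.mk₀_zero,
          Ext.comp_zero]
    | inr h =>
      have regF : IsRegular F rs := .of_isWeaklyRegular_of_mem_maximalIdeal F mem <|
        ((TensorProduct.rid A F).isWeaklyRegular_congr rs).mp reg.isWeaklyRegular_lTensor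
      refine ModuleCat.subsingleton_ext_of_exists_isRegular (maximalIdeal A) N hN F ?_ rs mem regF
        i hi
      exact (Submodule.top_ne_ideal_smul_of_le_jacobson_annihilator
        (maximalIdeal_le_jacobson _)).symm.lt_top
  induction p generalizing M i with
  | zero =>
    have : Projective M := (projective_iff_hasProjectiveDimensionLE_zero M).mpr ‹_›
    have : Module.Projective A M := (IsProjective.iff_projective M).mpr this
    exact flat M i (by lia)
  | succ p ih =>
    -- `Ext N M i` sits between `Ext N F i` and `Ext N (ker f) (i + 1)`, and the kernel has
    -- projective dimension at most `p`.
    obtain ⟨F, _, _, _, _, f, hf⟩ := Module.exists_finite_presentation A M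
    let S : ShortComplex (ModuleCat.{v} A) := f.shortComplexKer
    have hS : S.ShortExact := LinearMap.shortExact_shortComplexKer hf
    have hF : Subsingleton (Ext N S.X₂ i) := flat (ModuleCat.of A F) i (by lia)
    have hpd : HasProjectiveDimensionLE S.X₁ p :=
      (hS.hasProjectiveDimensionLT_X₃_iff p inferInstance).mp ‹_›
    have hfin : Module.Finite A S.X₁ := inferInstanceAs (Module.Finite A (LinearMap.ker f))
    have hK : Subsingleton (Ext N S.X₁ (i + 1)) := ih S.X₁ (i + 1) (by lia)
    refine subsingleton_of_forall_eq 0 fun (e : Ext N S.X₃ i) ↦ ?_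
    obtain ⟨e', rfl⟩ := Ext.covariant_sequence_exact₃ N hS e rfl (Subsingleton.elim _ _)
    rw [Subsingleton.elim e' 0, Ext.zero_comp]

/-- Over a Noetherian local ring with a regular sequence of length `n + p`, a nonzero finite module
of projective dimension at most `p` has a regular sequence of length `n`. -/
lemma exists_isRegular_of_hasProjectiveDimensionLE {A : Type u} [CommRing A] [Small.{v} A]
    [IsLocalRing A] [IsNoetherianRing A] (rs : List A) (mem : ∀ r ∈ rs, r ∈ maximalIdeal A)
    (reg : IsWeaklyRegular A rs) (M : Type v) [AddCommGroup M] [Module A M] [Module.Finite A M]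
    [Nontrivial M] (p : ℕ) [HasProjectiveDimensionLE (ModuleCat.of A M) p] (n : ℕ)
    (hn : n + p ≤ rs.length) :
    ∃ rs' : List A, rs'.length = n ∧ (∀ r ∈ rs', r ∈ maximalIdeal A) ∧ IsRegular M rs' := by
  have hlt : maximalIdeal A • (⊤ : Submodule A M) < ⊤ :=
    (Submodule.top_ne_ideal_smul_of_le_jacobson_annihilator (maximalIdeal_le_jacobson _)).symm.lt_top
  refine ((ModuleCat.exists_isRegular_tfae (maximalIdeal A) n (ModuleCat.of A M) hlt).out 0 3).mp ?_
  intro N _ _ hN i hi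
  exact subsingleton_ext_of_hasProjectiveDimensionLE rs mem reg N hN p _ i (by lia)

section Depth

variable {A : Type u} [CommRing A] [IsLocalRing A] {M : Type v} [AddCommGroup M] [Module A M]

lemma depth_eq_iSup [Module.Finite A M] [Nontrivial M] :
    depth A M = ⨆ rs : {rs : List A // IsRegular M rs ∧ ∀ r ∈ rs, r ∈ maximalIdeal A},
      (rs.1.length : ℕ∞) :=
  if_neg (Submodule.top_ne_ideal_smul_of_le_jacobson_annihilator
    (maximalIdeal_le_jacobson _)).symm

lemma exists_isRegular_of_le_depth [Module.Finite A M] [Nontrivial M] {n : ℕ}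
    (h : (n : ℕ∞) ≤ depth A M) :
    ∃ rs : List A, n ≤ rs.length ∧ (∀ r ∈ rs, r ∈ maximalIdeal A) ∧ IsRegular M rs := by
  rw [depth_eq_iSup] at h
  cases n with
  | zero => exact ⟨[], by simp, by simp, .nil A M⟩
  | succ n =>
    -- The supremum might be infinite and not attained, but some term exceeds `n`.
    obtain ⟨⟨rs, reg, mem⟩, hrs⟩ := lt_iSup_iff.mp
      (lt_of_lt_of_le (Nat.cast_lt.mpr n.lt_succ_self) h)
    exact ⟨rs, Nat.cast_lt.mp hrs, mem, reg⟩

lemma length_le_depth [Module.Finite A M] [Nontrivial M] {rs : List A} (reg : IsRegular M rs)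
    (mem : ∀ r ∈ rs, r ∈ maximalIdeal A) : (rs.length : ℕ∞) ≤ depth A M := by
  rw [depth_eq_iSup]
  exact le_iSup_of_le ⟨rs, reg, mem⟩ le_rfl

/-- Each term of a regular sequence lowers the dimension by one, and the final quotient is nonzero,
so its dimension is at least 0. -/
lemma depth_le_supportDim [IsNoetherianRing A] [Module.Finite A M] [Nontrivial M] :
    ((depth A M : ℕ∞) : WithBot ℕ∞) ≤ Module.supportDim A M := by
  obtain ⟨c, hc⟩ := WithBot.ne_bot_iff_exists.mp (Module.supportDim_ne_bot_of_nontrivial A M)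
  rw [depth_eq_iSup, ← hc, WithBot.coe_le_coe]
  refine iSup_le fun ⟨rs, reg, mem⟩ ↦ WithBot.coe_le_coe.mp ?_
  rw [hc, ← Module.supportDim_add_length_eq_supportDim_of_isRegular rs reg]
  have := reg.quot_ofList_smul_nontrivial ⊤
  obtain ⟨b, hb⟩ := WithBot.ne_bot_iff_exists.mp (Module.supportDim_ne_bot_of_nontrivial A
    (M ⧸ Ideal.ofList rs • (⊤ : Submodule A M)))
  rw [← hb]
  exact WithBot.coe_le_coe.mpr le_add_self

end Depth

end PureWeight

open PureWeight RingTheory.Sequence in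
theorem mainTheorem7 {A : Type u} [CommRing A] [IsLocalRing A] [Small.{v} A]
    (hA : PureWeight.IsCohenMacaulayLocalRing A)
    (d : ℕ) (hd : ringKrullDim A = d)
    (p : ℕ) (M : Type v) [AddCommGroup M] [Module A M] [Nontrivial M]
    (hM : PureWeight.IsPureWeight A p M) :
    (PureWeight.IsCohenMacaulayModule A M ∧
      p ≤ d ∧ Module.supportDim A M = ((d - p : ℕ) : WithBot ℕ∞)) ∧
    (∀ P : PrimeSpectrum A, IsAssociatedPrime P.asIdeal M →
      Minimal (fun Q => Q ∈ Module.support A M) P) := by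
  obtain ⟨hnoeth, hdepth⟩ := hA
  obtain ⟨I, ⟨xs, hxs, rfl, rfl⟩, hfin, hsupp, hpd⟩ := hM
  obtain ⟨rs, hlen, mem, reg⟩ := exists_isRegular_of_le_depth (A := A) (M := A) (n := d)
    (WithBot.coe_le_coe.mp (by rw [hdepth, hd]; rfl))
  have hdimI : ringKrullDim (A ⧸ Ideal.ofList xs) + xs.length = d := by
    rw [← hd]; exact ringKrullDim_add_length_eq_ringKrullDim_of_isRegular xs hxs
  have hnt : Nontrivial (A ⧸ Ideal.ofList xs) :=
    Ideal.Quotient.nontrivial_iff.mpr fun h ↦ hxs.top_ne_smul (by simp [h])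
  obtain ⟨hpd', hdimI'⟩ : xs.length ≤ d ∧
      ringKrullDim (A ⧸ Ideal.ofList xs) = ((d - xs.length : ℕ) : WithBot ℕ∞) := by
    -- Subtracting `p` requires ruling out the values `⊥` and `⊤` first.
    obtain ⟨b, hb⟩ := WithBot.ne_bot_iff_exists.mp
      (bot_lt_iff_ne_bot.mp (lt_of_lt_of_le (WithBot.bot_lt_coe 0)
        (ringKrullDim_nonneg_of_nontrivial (R := A ⧸ Ideal.ofList xs))))
    rw [← hb] at hdimI ⊢
    have hb' : b + xs.length = d := WithBot.coe_injective hdimI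
    cases b with
    | top => simp at hb'
    | coe b =>
      have hb'' : b + xs.length = d := by exact_mod_cast hb'
      exact ⟨by lia, by rw [← hb'', Nat.add_sub_cancel]; rfl⟩
  have hdim : Module.supportDim A M ≤ ((d - xs.length : ℕ) : WithBot ℕ∞) := by
    rw [← hdimI', ringKrullDim_quotient]
    exact Order.krullDim_le_of_strictMono (Set.inclusion hsupp) fun _ _ h ↦ h
  obtain ⟨ys, hys, ymem, yreg⟩ := exists_isRegular_of_hasProjectiveDimensionLE rs mem
    reg.toIsWeaklyRegular M xs.length (d - xs.length) (by lia)
  have hge : ((d - xs.length : ℕ) : WithBot ℕ∞) ≤ ((depth A M : ℕ∞) : WithBot ℕ∞) :=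
    WithBot.coe_le_coe.mpr (hys ▸ length_le_depth yreg ymem)
  refine ⟨⟨⟨hfin, .inr (depth_le_supportDim.antisymm (hdim.trans hge))⟩, hpd',
    hdim.antisymm (hge.trans depth_le_supportDim)⟩, fun P hP ↦ ⟨?_, fun Q hQ hle ↦ ?_⟩⟩
  · exact Module.mem_support_iff_of_finite.mpr (Submodule.annihilator_top (R := A) (M := M) ▸
      hP.annihilator_le)
  · by_contra hne
    obtain ⟨s, hs, hslen⟩ := exists_ltSeries_head_eq_of_isAssociatedPrime ys ymem
      yreg.toIsWeaklyRegular P hP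
    -- Prepending `Q` gives a chain of length `d - p + 1` in the support.
    have hlt : Q < s.head := hs ▸ lt_of_le_not_ge hle hne
    have := (length_le_supportDim (M := M) (s.cons Q hlt) (by simpa using hQ)).trans hdim
    rw [RelSeries.cons_length, hslen, hys] at this
    have : d - xs.length + 1 ≤ d - xs.length := by exact_mod_cast this
    lia
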